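/- Let $n\ge 1$, $\epsilon>0$, $\delta\in(0,1/16)$, and let $\mu_1\ge\mu_2\ge\dots\ge\mu_n$ be reals. Let $\rho=(\rho_1,\dots,\rho_n)$ be the bandit instance with $\rho_i=\mathcal N(\mu_i,1)$, put $m=|\{i\in[n]:\mu_i>\mu_1-\epsilon\}|$, and assume $m<n$. For a permutation $\pi$ of $[n]$ let $\pi(\rho)$ be the instance in which the arm at position $\pi(i)$ has distribution $\rho_i$, so that the $m$ best arms occupy the positions $\pi([m])$. Consider an algorithm that in each round pulls one arm, chosen as a measurable function of its internal randomness (a random seed that is independent of all rewards) and of the arms pulled and rewards observed in the earlier rounds, and then observes an independent sample from the distribution of that arm. Let $\mathcal F_t$ be the $\sigma$-algebra generated by the internal randomness and by the arms pulled and rewards observed in the first $t$ rounds, let $\widehat S_t\subseteq[n]$ be the $\mathcal F_t$-measurable set that the algorithm recommends after $t$ rounds, and let $\tau$ be its stopping time with respect to $(\mathcal F_t)_t$, possibly infinite. The rules for pulling, recommending and stopping are the same whatever instance the algorithm is run on. Let $k$ be such that, for every $\pi$, almost surely under $\mathbb P_{\pi(\rho)}$, $|\widehat S_\tau|=k$ whenever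 $\tau<\infty$. Let $T_i(\tau)$ be the number of times that arm $i$ is pulled up to time $\tau$. If $$\mathbb P_{\pi(\rho)}\big(\tau<\infty,\ \widehat S_\tau\subseteq\pi([m])\big)\ \ge\ 1-\delta\qquad\text{for every permutation }\pi\text{ of }[n],$$ then $$\frac1{n!}\sum_{\pi}\mathbb E_{\pi(\rho)}\Big[\sum_{i=1}^nT_{\pi(i)}(\tau)\Big]\ \ge\ \frac1{64}\Big(-(\mu_1-\mu_{m+1})^{-2}+\frac km\sum_{i=m+1}^n(\mu_1-\mu_i)^{-2}\Big),$$ where the sum on the left is over all permutations of $[n]$ and its value may be $+\infty$. -/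

import Mathlib

open MeasureTheory ProbabilityTheory

/-- A bandit algorithm for `n` arms whose internal randomness is a seed in `U`.
The history of the first `t` rounds lists the pairs (arm pulled, reward observed); rounds are
numbered from `0`. The algorithm knows nothing else about the instance it is run on.
* `pull t u h` is the arm pulled in the round that follows the history `h` of `t` rounds;
* `output t u h` is the set of arms that is recommended after `t` rounds. -/
structure BanditAlgorithm (n : ℕ) (U : Type*) [MeasurableSpace U] where
  pull : (t : ℕ) → U × (Fin t → Fin n × ℝ) → Fin n
  output : (t : ℕ) → U × (Fin t → Fin n × ℝ) → Finset (Fin n)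
  measurable_pull : ∀ t, Measurable (pull t)
  measurable_output : ∀ t, Measurable (output t)

namespace BanditAlgorithm

/-- Sample space of the interaction: a seed, and a table of rewards whose entry `(t, i)` is the
reward that is observed if arm `i` is pulled in round `t`. -/
abbrev Space (n : ℕ) (U : Type*) : Type _ := U × (ℕ → Fin n → ℝ)

variable {n : ℕ} {U : Type*} [MeasurableSpace U]

/-- What the algorithm has seen after `t` rounds: the arms pulled and the rewards observed. -/
def history (A : BanditAlgorithm n U) (ω : Space n U) : (t : ℕ) → Fin t → Fin n × ℝ
  | 0 => Fin.elim0
  | t + 1 =>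
    Fin.snoc (α := fun _ => Fin n × ℝ) (A.history ω t)
      (A.pull t (ω.1, A.history ω t), ω.2 t (A.pull t (ω.1, A.history ω t)))

/-- The information after `t` rounds: the seed and the history. -/
def info (A : BanditAlgorithm n U) (t : ℕ) (ω : Space n U) : U × (Fin t → Fin n × ℝ) :=
  (ω.1, A.history ω t)

/-- The arm pulled in round `t`. -/
def arm (A : BanditAlgorithm n U) (t : ℕ) (ω : Space n U) : Fin n :=
  A.pull t (A.info t ω)

/-- The set recommended after `t` rounds. -/
def recommendation (A : BanditAlgorithm n U) (t : ℕ) (ω : Space n U) : Finset (Fin n) :=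
  A.output t (A.info t ω)

lemma measurable_info (A : BanditAlgorithm n U) (t : ℕ) : Measurable (A.info t) := by
  induction t with
  | zero =>
    refine measurable_fst.prodMk ?_
    exact measurable_pi_lambda _ (fun i => i.elim0)
  | succ t ih =>
    have hp : Measurable (fun ω : Space n U => A.pull t (ω.1, A.history ω t)) :=
      (A.measurable_pull t).comp ih
    have hx : Measurable
        (fun ω : Space n U => ω.2 t (A.pull t (ω.1, A.history ω t))) := by
      have he : Measurable (fun p : (Fin n → ℝ) × Fin n => p.1 p.2) :=
        measurable_from_prod_countable_left (fun i => measurable_pi_apply i)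
      exact he.comp (((measurable_pi_apply t).comp measurable_snd).prodMk hp)
    refine measurable_fst.prodMk (measurable_pi_lambda _ (fun i => ?_))
    refine Fin.lastCases ?_ (fun j => ?_) i
    · simpa [history] using hp.prodMk hx
    · have hj : Measurable (fun ω : Space n U => A.history ω t j) :=
        (measurable_pi_apply j).comp (measurable_snd.comp ih)
      simpa [history] using hj

/-- The filtration generated by the algorithm: the σ-algebra at time `t` is generated by the
internal randomness and by the arms pulled and the rewards observed in the first `t` rounds. -/
def filtration (A : BanditAlgorithm n U) :
    Filtration ℕ (inferInstance : MeasurableSpace (Space n U)) where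
  seq t := MeasurableSpace.comap (A.info t) inferInstance
  mono' := by
    refine monotone_nat_of_le_succ (fun t => ?_)
    have hr : Measurable (fun p : U × (Fin (t + 1) → Fin n × ℝ) =>
        ((p.1, fun j : Fin t => p.2 j.castSucc) : U × (Fin t → Fin n × ℝ))) :=
      measurable_fst.prodMk (measurable_pi_lambda _
        (fun j => (measurable_pi_apply j.castSucc).comp measurable_snd))
    have he : A.info t = (fun p : U × (Fin (t + 1) → Fin n × ℝ) =>
        ((p.1, fun j : Fin t => p.2 j.castSucc) : U × (Fin t → Fin n × ℝ))) ∘ A.info (t + 1) := by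
      funext ω
      simp [info, history]
    rw [he, ← MeasurableSpace.comap_comp]
    exact MeasurableSpace.comap_mono hr.comap_le
  le' t := (A.measurable_info t).comap_le

/-- `T_i(τ)`: the number of pulls of arm `i` in the rounds before time `τ`; it may be infinite
if `τ = ⊤`. -/
noncomputable def pulls (A : BanditAlgorithm n U) (i : Fin n) (τ : Space n U → WithTop ℕ)
    (ω : Space n U) : ENNReal :=
  ∑' t : ℕ, Set.indicator {s : ℕ | (s : WithTop ℕ) < τ ω ∧ A.arm s ω = i} 1 t

end BanditAlgorithm

/-- The law of seed and rewards if the seed has law `ν` and the instance is `ρ`: all rewards are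
independent of each other and of the seed, and those of arm `i` have distribution `ρ i`. -/
noncomputable def banditLaw {n : ℕ} {U : Type*} [MeasurableSpace U] (ν : Measure U)
    (ρ : Fin n → Measure ℝ) : Measure (BanditAlgorithm.Space n U) :=
  ν.prod (Measure.infinitePi fun _ : ℕ => Measure.pi ρ)

/-- The instance with unit-variance Gaussian rewards and means `μ`. -/
noncomputable def gaussianInstance {n : ℕ} (μ : Fin n → ℝ) : Fin n → Measure ℝ :=
  fun i => gaussianReal (μ i) 1

/-- The instance `π(ρ)`, in which the arm at position `π i` is the arm `i` of `ρ`. -/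
def permuteInstance {n : ℕ} (π : Equiv.Perm (Fin n)) (ρ : Fin n → Measure ℝ) :
    Fin n → Measure ℝ :=
  fun j => ρ (π.symm j)

/-- The set `π([m])` of the positions of the arms `0, …, m - 1` in the permuted instance. -/
def topPositions {n : ℕ} (π : Equiv.Perm (Fin n)) (m : ℕ) : Finset (Fin n) :=
  (Finset.univ.filter fun i : Fin n => (i : ℕ) < m).map π.toEmbedding

/-! The proof is an exchange argument, averaged over permutations. Fix a top arm `j` and let `i` be
any arm outside the top `m`. Raising the mean at position `π i` to `μ j` makes the positions of `i`
and `j` indistinguishable, so the modified instances for `π` and for `π * Equiv.swap i j` coincide.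
Hence, summed over `π`, the correct event `hitEvent τ m j π` and its swapped version `hitEvent τ m j
(π * Equiv.swap i j)` have the same total probability under the modified laws.

Passing to the modified law and back costs a factor 2 each way, plus the squared gap times the
expected number of pulls of position `π i` under the original law (`real_le_add_pulls`). The result
is `sum_real_hitEvent_le`.

Under the original law the swapped events are errors, since the output contains `π i`. For different
`i` they are disjoint, so their probabilities add up to at most `δ` (`sum_real_hitEvent_swap_le`). A
correct output contains `k` of the `m` top positions, so some `j` is hit with average probability at
least `(k / m) * (1 - δ)` (`card_mul_real_le_sum_real_hitEvent`). Each arm `i` therefore needs about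
`k / m` over its squared gap in pulls, unless it absorbs part of the error budget. Dividing by the
squared gaps and summing, the error budget costs at most a multiple of the largest inverse squared
gap, whence the negative term (`sum_ge_of_le_add`). -/

/-! ### Resampling one round of rewards. -/

/-- Replacing one coordinate by an independent copy preserves a product of probability measures. -/
lemma measurePreserving_update_infinitePi {ι : Type*} [DecidableEq ι] {X : ι → Type*}
    [∀ i, MeasurableSpace (X i)] (μ : (i : ι) → Measure (X i)) [∀ i, IsProbabilityMeasure (μ i)]
    (i : ι) :
    MeasurePreserving (fun p : (Π j, X j) × X i => Function.update p.1 i p.2)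
      ((Measure.infinitePi μ).prod (μ i)) (Measure.infinitePi μ) := by
  have hmeas : Measurable (fun p : (Π j, X j) × X i => Function.update p.1 i p.2) := by
    refine measurable_pi_lambda _ fun j => ?_
    by_cases h : j = i
    · subst h
      simpa using measurable_snd
    · have hj : Measurable (fun p : (Π j, X j) × X i => p.1 j) :=
        (measurable_pi_apply j).comp measurable_fst
      simpa [Function.update_of_ne h] using hj
  refine ⟨hmeas, Measure.eq_infinitePi _ fun s B hB => ?_⟩
  rw [Measure.map_apply hmeas (MeasurableSet.pi s.countable_toSet fun j _ => hB j)]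
  -- Coordinate `i` is read from the second factor, so its constraint moves there and `i` leaves the
  -- index set of the first.
  have hset : (fun p : (Π j, X j) × X i => Function.update p.1 i p.2) ⁻¹' (Set.pi s B)
      = (Set.pi (s.erase i : Finset ι) B) ×ˢ (if i ∈ s then B i else Set.univ) := by
    ext p
    simp only [Set.mem_preimage, Set.mem_pi, Set.mem_prod, Finset.mem_coe, Finset.mem_erase]
    constructor
    · intro h
      refine ⟨fun j hj => ?_, ?_⟩
      · simpa [Function.update_of_ne hj.1] using h j hj.2
      · split_ifs with hi
        · simpa using h i hi
        · trivial
    · rintro ⟨h1, h2⟩ j hj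
      by_cases hji : j = i
      · subst hji
        simpa [hj] using h2
      · simpa [Function.update_of_ne hji] using h1 j ⟨hji, hj⟩
  rw [hset, Measure.prod_prod, Measure.infinitePi_pi _ fun j _ => hB j]
  split_ifs with hi
  · rw [Finset.prod_erase_mul _ _ hi]
  · rw [measure_univ, mul_one, Finset.erase_eq_of_notMem hi]

instance {n : ℕ} {U : Type*} [MeasurableSpace U] (ν : Measure U) [IsProbabilityMeasure ν]
    (ρ : Fin n → Measure ℝ) [∀ i, IsProbabilityMeasure (ρ i)] :
    IsProbabilityMeasure (banditLaw ν ρ) := by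
  unfold banditLaw
  infer_instance

namespace BanditAlgorithm

variable {n : ℕ} {U : Type*} [MeasurableSpace U]

/-- Replace the rewards of round `t` by a given row. -/
def resample (t : ℕ) (p : Space n U × (Fin n → ℝ)) : Space n U :=
  (p.1.1, Function.update p.1.2 t p.2)

lemma measurePreserving_resample (ν : Measure U) [IsProbabilityMeasure ν]
    (ρ : Fin n → Measure ℝ) [∀ i, IsProbabilityMeasure (ρ i)] (t : ℕ) :
    MeasurePreserving (resample (U := U) t) ((banditLaw ν ρ).prod (Measure.pi ρ))
      (banditLaw ν ρ) :=
  ((MeasurePreserving.id ν).prod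
    (measurePreserving_update_infinitePi (fun _ : ℕ => Measure.pi ρ) t)).comp
      (measurePreserving_prodAssoc ν (Measure.infinitePi fun _ : ℕ => Measure.pi ρ) (Measure.pi ρ))

/-- This takes the place of conditioning on the first `t` rounds: the inner integral averages over a
fresh row `t` while everything earlier stays fixed. -/
lemma lintegral_resample (ν : Measure U) [IsProbabilityMeasure ν]
    (ρ : Fin n → Measure ℝ) [∀ i, IsProbabilityMeasure (ρ i)] (t : ℕ)
    {F : Space n U → ENNReal} (hF : Measurable F) :
    ∫⁻ ω, F ω ∂(banditLaw ν ρ)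
      = ∫⁻ ω, ∫⁻ x, F (resample t (ω, x)) ∂(Measure.pi ρ) ∂(banditLaw ν ρ) := by
  have h := measurePreserving_resample ν ρ t
  rw [← h.lintegral_comp hF]
  exact lintegral_prod _ (hF.comp h.measurable).aemeasurable

lemma info_resample (A : BanditAlgorithm n U) {s t : ℕ} (hst : s ≤ t)
    (p : Space n U × (Fin n → ℝ)) : A.info s (resample t p) = A.info s p.1 := by
  induction s with
  | zero => exact Prod.ext rfl (funext fun i => i.elim0)
  | succ s ih =>
    have ih' : A.history (resample t p) s = A.history p.1 s :=
      congrArg Prod.snd (ih (by omega))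
    have hs : (resample t p).2 s = p.1.2 s := Function.update_of_ne (by omega) _ _
    have h1 : (resample t p).1 = p.1.1 := rfl
    simp only [info, history, ih', hs, h1]

lemma arm_resample (A : BanditAlgorithm n U) {s t : ℕ} (hst : s ≤ t)
    (p : Space n U × (Fin n → ℝ)) : A.arm s (resample t p) = A.arm s p.1 := by
  rw [arm, arm, info_resample A hst]

/-- An event known after `s ≤ t` rounds cannot depend on row `t`, because the history up to `s`
reads only rows below `s`. -/
lemma mem_resample_iff (A : BanditAlgorithm n U) {s t : ℕ} (hst : s ≤ t) {B : Set (Space n U)}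
    (hB : MeasurableSet[A.filtration s] B) (p : Space n U × (Fin n → ℝ)) :
    resample t p ∈ B ↔ p.1 ∈ B := by
  obtain ⟨C, -, rfl⟩ := hB
  simp only [Set.mem_preimage, info_resample A hst]

lemma measurable_arm (A : BanditAlgorithm n U) (t : ℕ) : Measurable (A.arm t) :=
  (A.measurable_pull t).comp (A.measurable_info t)

lemma measurableSet_arm_eq (A : BanditAlgorithm n U) (t : ℕ) (a : Fin n) :
    MeasurableSet[A.filtration t] {ω | A.arm t ω = a} :=
  ⟨A.pull t ⁻¹' {a}, A.measurable_pull t (measurableSet_singleton a), rfl⟩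

/-- The reward observed in round `t`. -/
def reward (A : BanditAlgorithm n U) (t : ℕ) (ω : Space n U) : ℝ := ω.2 t (A.arm t ω)

lemma measurable_entry (t : ℕ) (a : Fin n) : Measurable (fun ω : Space n U => ω.2 t a) :=
  (measurable_pi_apply a).comp ((measurable_pi_apply t).comp measurable_snd)

lemma measurable_eval_pair : Measurable (fun p : (Fin n → ℝ) × Fin n => p.1 p.2) :=
  measurable_from_prod_countable_left fun i => measurable_pi_apply i

lemma measurable_reward (A : BanditAlgorithm n U) (t : ℕ) : Measurable (A.reward t) :=
  measurable_eval_pair.comp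
    (((measurable_pi_apply t).comp measurable_snd).prodMk (A.measurable_arm t))

lemma reward_resample (A : BanditAlgorithm n U) {s t : ℕ} (hst : s < t)
    (p : Space n U × (Fin n → ℝ)) : A.reward s (resample t p) = A.reward s p.1 := by
  have hs : (resample t p).2 s = p.1.2 s := Function.update_of_ne (by omega) _ _
  rw [reward, reward, arm_resample A hst.le, hs]

lemma reward_resample_self (A : BanditAlgorithm n U) (t : ℕ)
    (p : Space n U × (Fin n → ℝ)) : A.reward t (resample t p) = p.2 (A.arm t p.1) := by
  have hs : (resample t p).2 t = p.2 := Function.update_self _ _ _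
  rw [reward, arm_resample A le_rfl, hs]

/-! ### Change of measure over a fixed number of rounds. -/

/-- Append the round in which `pull` is followed by the reward read off a row of rewards. -/
def extend (A : BanditAlgorithm n U) (t : ℕ) (q : (U × (Fin t → Fin n × ℝ)) × (Fin n → ℝ)) :
    U × (Fin (t + 1) → Fin n × ℝ) :=
  (q.1.1, Fin.snoc (α := fun _ => Fin n × ℝ) q.1.2 (A.pull t q.1, q.2 (A.pull t q.1)))

lemma measurable_extend (A : BanditAlgorithm n U) (t : ℕ) : Measurable (A.extend t) := by
  have hp : Measurable (fun q : (U × (Fin t → Fin n × ℝ)) × (Fin n → ℝ) => A.pull t q.1) :=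
    (A.measurable_pull t).comp measurable_fst
  refine (measurable_fst.comp measurable_fst).prodMk (measurable_pi_lambda _ fun i => ?_)
  refine Fin.lastCases ?_ (fun j => ?_) i
  · simpa using hp.prodMk (measurable_eval_pair.comp (measurable_snd.prodMk hp))
  · have hj : Measurable (fun q : (U × (Fin t → Fin n × ℝ)) × (Fin n → ℝ) => q.1.2 j) :=
      (measurable_pi_apply j).comp (measurable_snd.comp measurable_fst)
    simpa using hj

lemma info_succ_resample (A : BanditAlgorithm n U) (t : ℕ) (p : Space n U × (Fin n → ℝ)) :
    A.info (t + 1) (resample t p) = A.extend t (A.info t p.1, p.2) := by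
  have h : A.info (t + 1) (resample t p)
      = A.extend t (A.info t (resample t p), (resample t p).2 t) := rfl
  have hs : (resample t p).2 t = p.2 := Function.update_self _ _ _
  rw [h, info_resample A le_rfl, hs]

/-- The likelihood ratio of the first `t` rounds, if `r a` is the density of the new reward
distribution of arm `a` with respect to the old one. -/
noncomputable def likelihood (A : BanditAlgorithm n U) (r : Fin n → ℝ → ENNReal) (t : ℕ)
    (ω : Space n U) : ENNReal :=
  ∏ s ∈ Finset.range t, r (A.arm s ω) (A.reward s ω)

lemma measurable_density {r : Fin n → ℝ → ENNReal} (hr : ∀ a, Measurable (r a)) :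
    Measurable (fun p : Fin n × ℝ => r p.1 p.2) :=
  measurable_from_prod_countable_right hr

lemma measurable_likelihood (A : BanditAlgorithm n U) {r : Fin n → ℝ → ENNReal}
    (hr : ∀ a, Measurable (r a)) (t : ℕ) : Measurable (A.likelihood r t) :=
  Finset.measurable_prod _ fun s _ =>
    (measurable_density hr).comp ((A.measurable_arm s).prodMk (A.measurable_reward s))

/-- Change of measure for functions of the first `t` rounds. -/
lemma lintegral_info_withDensity (A : BanditAlgorithm n U) (ν : Measure U) [IsProbabilityMeasure ν]
    (ρ ρ' : Fin n → Measure ℝ) [∀ i, IsProbabilityMeasure (ρ i)]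
    [∀ i, IsProbabilityMeasure (ρ' i)] {r : Fin n → ℝ → ENNReal} (hr : ∀ a, Measurable (r a))
    (hρ : ∀ a, ρ' a = (ρ a).withDensity (r a)) (t : ℕ)
    {f : U × (Fin t → Fin n × ℝ) → ENNReal} (hf : Measurable f) :
    ∫⁻ ω, f (A.info t ω) ∂(banditLaw ν ρ')
      = ∫⁻ ω, f (A.info t ω) * A.likelihood r t ω ∂(banditLaw ν ρ) := by
  induction t with
  | zero =>
    simp only [likelihood, Finset.range_zero, Finset.prod_empty, mul_one]
    have h : ∀ ω : Space n U, f (A.info 0 ω) = f (ω.1, Fin.elim0) := fun _ => rfl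
    simp only [h]
    have hg : Measurable fun u : U => f (u, Fin.elim0) := hf.comp measurable_prodMk_right
    have key : ∀ κ : Measure (ℕ → Fin n → ℝ), IsProbabilityMeasure κ →
        ∫⁻ ω, f (ω.1, Fin.elim0) ∂(ν.prod κ) = ∫⁻ u, f (u, Fin.elim0) ∂ν := by
      intro κ _
      rw [lintegral_prod _ (by fun_prop)]
      simp
    unfold banditLaw
    rw [key _ inferInstance, key _ inferInstance]
  | succ t ih =>
    have hfe : Measurable (fun q => f (A.extend t q)) := hf.comp (A.measurable_extend t)
    have hG : Measurable (fun h => ∫⁻ x, f (A.extend t (h, x)) ∂(Measure.pi ρ')) :=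
      hfe.lintegral_prod_right'
    have hfi : Measurable (fun ω => f (A.info (t + 1) ω)) := hf.comp (A.measurable_info _)
    have hfL : Measurable (fun ω => f (A.info (t + 1) ω) * A.likelihood r (t + 1) ω) :=
      hfi.mul (A.measurable_likelihood hr (t + 1))
    -- the value of the appended round depends only on the reward of the pulled arm
    have heval : ∀ (h : U × (Fin t → Fin n × ℝ)),
        ∫⁻ x, f (A.extend t (h, x)) ∂(Measure.pi ρ')
          = ∫⁻ x, f (A.extend t (h, x)) * r (A.pull t h) (x (A.pull t h)) ∂(Measure.pi ρ) := by
      intro h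
      set b := A.pull t h with hb
      let φ : ℝ → ENNReal := fun y =>
        f (h.1, Fin.snoc (α := fun _ => Fin n × ℝ) h.2 (b, y))
      have hφ : Measurable φ := by
        have : φ = fun y => f (A.extend t (h, fun _ => y)) := rfl
        rw [this]
        exact hfe.comp (measurable_const.prodMk (measurable_pi_lambda _ fun _ => measurable_id))
      have h1 : ∀ x : Fin n → ℝ, f (A.extend t (h, x)) = φ (x b) := fun _ => rfl
      simp only [h1]
      rw [(measurePreserving_eval ρ' b).lintegral_comp (f := φ) hφ,
        (measurePreserving_eval ρ b).lintegral_comp (f := fun y => φ y * r b y)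
          (hφ.mul (hr b)), hρ b, lintegral_withDensity_eq_lintegral_mul _ (hr b) hφ]
      exact lintegral_congr fun y => mul_comm _ _
    rw [lintegral_resample ν ρ' t hfi, lintegral_resample ν ρ t hfL]
    simp only [info_succ_resample]
    -- The induction hypothesis applies to the function of the shorter history that is left after
    -- the last row is integrated out under the new law.
    rw [ih hG]
    refine lintegral_congr fun ω => ?_
    have hl : ∀ x, A.likelihood r (t + 1) (resample t (ω, x))
        = A.likelihood r t ω * r (A.arm t ω) (x (A.arm t ω)) := by
      intro x
      rw [likelihood, Finset.prod_range_succ, reward_resample_self, arm_resample A le_rfl,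
        likelihood]
      congr 1
      refine Finset.prod_congr rfl fun s hs => ?_
      have hs' := Finset.mem_range.1 hs
      rw [reward_resample A hs', arm_resample A hs'.le]
    simp only [hl]
    rw [heval, ← lintegral_mul_const]
    · refine lintegral_congr fun x => ?_
      rw [arm, mul_assoc, mul_comm (A.likelihood r t ω)]
    · exact (hfe.comp measurable_prodMk_left).mul
        ((hr _).comp (measurable_pi_apply _))

end BanditAlgorithm

/-! ### Gaussian likelihood ratios. -/

/-- The log-likelihood ratio of `N(v', 1)` with respect to `N(v, 1)`. -/
noncomputable def gaussianLogRatio (v v' x : ℝ) : ℝ := (v' - v) * x - (v' ^ 2 - v ^ 2) / 2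

lemma measurable_gaussianLogRatio (v v' : ℝ) : Measurable (gaussianLogRatio v v') := by
  unfold gaussianLogRatio
  fun_prop

lemma gaussianReal_eq_withDensity (v v' : ℝ) :
    gaussianReal v' 1
      = (gaussianReal v 1).withDensity
          (fun x => ENNReal.ofReal (Real.exp (gaussianLogRatio v v' x))) := by
  have hm : Measurable (fun x => ENNReal.ofReal (Real.exp (gaussianLogRatio v v' x))) :=
    (Real.measurable_exp.comp (measurable_gaussianLogRatio v v')).ennreal_ofReal
  rw [gaussianReal_of_var_ne_zero v' one_ne_zero, gaussianReal_of_var_ne_zero v one_ne_zero,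
    ← withDensity_mul _ (measurable_gaussianPDF v 1) hm]
  congr 1
  funext x
  rw [Pi.mul_apply, gaussianPDF, gaussianPDF, ← ENNReal.ofReal_mul (gaussianPDFReal_nonneg _ _ _),
    gaussianPDFReal, gaussianPDFReal, mul_assoc (Real.sqrt _)⁻¹,
    ← Real.exp_add]
  congr 4
  simp only [gaussianLogRatio, NNReal.coe_one]
  ring

lemma integrable_gaussianLogRatio (v v' : ℝ) :
    Integrable (gaussianLogRatio v v') (gaussianReal v 1) := by
  have h : Integrable (fun x : ℝ => x) (gaussianReal v 1) :=
    (memLp_id_gaussianReal' 1 ENNReal.one_ne_top).integrable le_rfl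
  exact (h.const_mul _).sub (integrable_const _)

/-- This is minus the Kullback–Leibler divergence of the two unit-variance Gaussians; it is the
source of the squared gaps. -/
lemma integral_gaussianLogRatio (v v' : ℝ) :
    ∫ x, gaussianLogRatio v v' x ∂(gaussianReal v 1) = -((v' - v) ^ 2 / 2) := by
  have h : Integrable (fun x : ℝ => x) (gaussianReal v 1) :=
    (memLp_id_gaussianReal' 1 ENNReal.one_ne_top).integrable le_rfl
  unfold gaussianLogRatio
  rw [integral_sub (h.const_mul _) (integrable_const _), integral_const_mul, integral_id_gaussianReal]
  simp
  ring

instance {n : ℕ} (v : Fin n → ℝ) (i : Fin n) : IsProbabilityMeasure (gaussianInstance v i) := by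
  unfold gaussianInstance
  infer_instance

/-! ### Change of measure at a stopping time, and its cost in pulls. -/

namespace BanditAlgorithm

variable {n : ℕ} {U : Type*} [MeasurableSpace U]

lemma measure_eq_setLIntegral_likelihood (A : BanditAlgorithm n U) (ν : Measure U)
    [IsProbabilityMeasure ν] (ρ ρ' : Fin n → Measure ℝ) [∀ i, IsProbabilityMeasure (ρ i)]
    [∀ i, IsProbabilityMeasure (ρ' i)] {r : Fin n → ℝ → ENNReal} (hr : ∀ a, Measurable (r a))
    (hρ : ∀ a, ρ' a = (ρ a).withDensity (r a)) (t : ℕ) {B : Set (Space n U)}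
    (hB : MeasurableSet[A.filtration t] B) :
    banditLaw ν ρ' B = ∫⁻ ω in B, A.likelihood r t ω ∂(banditLaw ν ρ) := by
  have hB' := A.filtration.le t B hB
  obtain ⟨C, hC, rfl⟩ := hB
  have h := A.lintegral_info_withDensity ν ρ ρ' hr hρ t
    (f := C.indicator 1) (measurable_one.indicator hC)
  rw [← lintegral_indicator_one hB', ← lintegral_indicator hB']
  refine Eq.trans rfl (h.trans (lintegral_congr fun ω => ?_))
  by_cases hω : A.info t ω ∈ C <;> simp [Set.indicator, hω]

/-- Change of measure at a finite random time. -/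
lemma measure_eq_setLIntegral_likelihood_stopped (A : BanditAlgorithm n U) (ν : Measure U)
    [IsProbabilityMeasure ν] (ρ ρ' : Fin n → Measure ℝ) [∀ i, IsProbabilityMeasure (ρ i)]
    [∀ i, IsProbabilityMeasure (ρ' i)] {r : Fin n → ℝ → ENNReal} (hr : ∀ a, Measurable (r a))
    (hρ : ∀ a, ρ' a = (ρ a).withDensity (r a)) (σ : Space n U → ℕ) {B : Set (Space n U)}
    (hB : ∀ s, MeasurableSet[A.filtration s] (B ∩ {ω | σ ω = s})) :
    banditLaw ν ρ' B = ∫⁻ ω in B, A.likelihood r (σ ω) ω ∂(banditLaw ν ρ) := by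
  have hU : B = ⋃ s, B ∩ {ω | σ ω = s} := by
    ext ω
    simp
  have hd : Pairwise (Function.onFun Disjoint fun s => B ∩ {ω | σ ω = s}) := by
    intro s s' hs
    refine Set.disjoint_left.2 fun ω h h' => hs ?_
    exact h.2.symm.trans h'.2
  have hm : ∀ s, MeasurableSet (B ∩ {ω | σ ω = s}) := fun s => A.filtration.le s _ (hB s)
  conv_lhs => rw [hU]
  conv_rhs => rw [hU]
  rw [measure_iUnion hd hm, lintegral_iUnion hm hd]
  refine tsum_congr fun s => ?_
  rw [A.measure_eq_setLIntegral_likelihood ν ρ ρ' hr hρ s (hB s)]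
  refine setLIntegral_congr_fun (hm s) fun ω hω => ?_
  have : σ ω = s := hω.2
  simp only [this]

/-- The rounds before time `τ` in which arm `a` is pulled. -/
def pulledAt (A : BanditAlgorithm n U) (a : Fin n) (τ : Space n U → WithTop ℕ) (s : ℕ) :
    Set (Space n U) :=
  {ω | (s : WithTop ℕ) < τ ω ∧ A.arm s ω = a}

/-- Whether round `s` takes place, and with which arm, is settled before row `s` is read. This
predictability is what makes `integral_step` factor. -/
lemma measurableSet_pulledAt (A : BanditAlgorithm n U) (a : Fin n) {τ : Space n U → WithTop ℕ}
    (hτ : IsStoppingTime A.filtration τ) (s : ℕ) :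
    MeasurableSet[A.filtration s] (A.pulledAt a τ s) :=
  (hτ.measurableSet_gt s).inter (A.measurableSet_arm_eq s a)

lemma lintegral_pulls (A : BanditAlgorithm n U) (a : Fin n) {τ : Space n U → WithTop ℕ}
    (hτ : IsStoppingTime A.filtration τ) (P : Measure (Space n U)) :
    ∫⁻ ω, A.pulls a τ ω ∂P = ∑' s, P (A.pulledAt a τ s) := by
  have hm : ∀ s, MeasurableSet (A.pulledAt a τ s) := fun s =>
    A.filtration.le s _ (A.measurableSet_pulledAt a hτ s)
  have h : ∀ ω, A.pulls a τ ω = ∑' s, (A.pulledAt a τ s).indicator 1 ω := fun ω => rfl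
  simp only [h]
  rw [lintegral_tsum fun s => (measurable_one.indicator (hm s)).aemeasurable]
  exact tsum_congr fun s => lintegral_indicator_one (hm s)

/-- The log-likelihood ratio at time `min τ t` if the mean of arm `a` changes from `v` to `v'`. -/
noncomputable def stoppedLogLikelihood (A : BanditAlgorithm n U) (a : Fin n)
    (τ : Space n U → WithTop ℕ) (v v' : ℝ) (t : ℕ) (ω : Space n U) : ℝ :=
  ∑ s ∈ Finset.range t, (A.pulledAt a τ s).indicator (fun ω => gaussianLogRatio v v' (ω.2 s a)) ω

lemma measurable_stoppedLogLikelihood (A : BanditAlgorithm n U) (a : Fin n)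
    {τ : Space n U → WithTop ℕ} (hτ : IsStoppingTime A.filtration τ) (v v' : ℝ) (t : ℕ) :
    Measurable (A.stoppedLogLikelihood a τ v v' t) := by
  refine Finset.measurable_sum _ fun s _ => Measurable.indicator ?_
    (A.filtration.le s _ (A.measurableSet_pulledAt a hτ s))
  exact (measurable_gaussianLogRatio v v').comp (measurable_entry s a)

lemma integrable_step (A : BanditAlgorithm n U) (ν : Measure U)
    [IsProbabilityMeasure ν] (w : Fin n → ℝ) (a : Fin n) {τ : Space n U → WithTop ℕ}
    (hτ : IsStoppingTime A.filtration τ) (v' : ℝ) (s : ℕ) :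
    Integrable ((A.pulledAt a τ s).indicator (fun ω => gaussianLogRatio (w a) v' (ω.2 s a)))
      (banditLaw ν (gaussianInstance w)) := by
  refine Integrable.indicator ?_ (A.filtration.le s _ (A.measurableSet_pulledAt a hτ s))
  have h1 : MeasurePreserving (fun ω : Space n U => ω.2 s a)
      (banditLaw ν (gaussianInstance w)) (gaussianReal (w a) 1) := by
    have h := (measurePreserving_eval (gaussianInstance w) a).comp
      ((measurePreserving_eval_infinitePi (fun _ : ℕ => Measure.pi (gaussianInstance w)) s).comp
        (measurePreserving_snd (μ := ν)))
    exact h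
  exact h1.integrable_comp_of_integrable (integrable_gaussianLogRatio _ _)

/-- One term of Wald's identity: after row `s` is resampled, the indicator depends on the past and
the log-ratio on the fresh row, so the integral is a product. -/
lemma integral_step (A : BanditAlgorithm n U) (ν : Measure U)
    [IsProbabilityMeasure ν] (w : Fin n → ℝ) (a : Fin n) {τ : Space n U → WithTop ℕ}
    (hτ : IsStoppingTime A.filtration τ) (v' : ℝ) (s : ℕ) :
    ∫ ω, (A.pulledAt a τ s).indicator (fun ω => gaussianLogRatio (w a) v' (ω.2 s a)) ω
        ∂(banditLaw ν (gaussianInstance w))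
      = -((v' - w a) ^ 2 / 2) * (banditLaw ν (gaussianInstance w)).real (A.pulledAt a τ s) := by
  have hS := A.measurableSet_pulledAt a hτ s
  have hS' := A.filtration.le s _ hS
  have hp := measurePreserving_resample (U := U) ν (gaussianInstance w) s
  have hev := measurePreserving_eval (gaussianInstance w) a
  have hI := A.integrable_step ν w a hτ v' s
  conv_lhs => rw [← hp.map_eq]
  rw [integral_map hp.measurable.aemeasurable (by rw [hp.map_eq]; exact hI.aestronglyMeasurable)]
  have heq : ∀ p : Space n U × (Fin n → ℝ),
      (A.pulledAt a τ s).indicator (fun ω => gaussianLogRatio (w a) v' (ω.2 s a)) (resample s p)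
        = (A.pulledAt a τ s).indicator 1 p.1 * gaussianLogRatio (w a) v' (p.2 a) := by
    intro p
    have h2 : (resample s p).2 s = p.2 := Function.update_self _ _ _
    have h3 := A.mem_resample_iff le_rfl hS p
    by_cases h : p.1 ∈ A.pulledAt a τ s
    · rw [Set.indicator_of_mem (h3.2 h), Set.indicator_of_mem h, h2]
      simp
    · rw [Set.indicator_of_notMem (fun h' => h (h3.1 h')), Set.indicator_of_notMem h, zero_mul]
  simp only [heq]
  rw [integral_prod_mul (fun ω => (A.pulledAt a τ s).indicator (1 : Space n U → ℝ) ω)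
    (fun x : Fin n → ℝ => gaussianLogRatio (w a) v' (x a)), integral_indicator_one hS']
  have h4 : ∫ x : Fin n → ℝ, gaussianLogRatio (w a) v' (x a) ∂(Measure.pi (gaussianInstance w))
      = -((v' - w a) ^ 2 / 2) := by
    rw [← integral_gaussianLogRatio (w a) v']
    have h5 := hev.map_eq
    change _ = ∫ x, gaussianLogRatio (w a) v' x ∂(gaussianInstance w a)
    rw [← h5, integral_map hev.measurable.aemeasurable
      (measurable_gaussianLogRatio _ _).aestronglyMeasurable]
  rw [h4, mul_comm]

lemma integrable_stoppedLogLikelihood (A : BanditAlgorithm n U) (ν : Measure U)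
    [IsProbabilityMeasure ν] (w : Fin n → ℝ) (a : Fin n) {τ : Space n U → WithTop ℕ}
    (hτ : IsStoppingTime A.filtration τ) (v' : ℝ) (t : ℕ) :
    Integrable (A.stoppedLogLikelihood a τ (w a) v' t) (banditLaw ν (gaussianInstance w)) :=
  integrable_finsetSum _ fun s _ => A.integrable_step ν w a hτ v' s

lemma integral_stoppedLogLikelihood (A : BanditAlgorithm n U) (ν : Measure U)
    [IsProbabilityMeasure ν] (w : Fin n → ℝ) (a : Fin n) {τ : Space n U → WithTop ℕ}
    (hτ : IsStoppingTime A.filtration τ) (v' : ℝ) (t : ℕ) :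
    ∫ ω, A.stoppedLogLikelihood a τ (w a) v' t ω ∂(banditLaw ν (gaussianInstance w))
      = -((v' - w a) ^ 2 / 2) * ∑ s ∈ Finset.range t,
          (banditLaw ν (gaussianInstance w)).real (A.pulledAt a τ s) := by
  unfold stoppedLogLikelihood
  rw [integral_finsetSum _ fun s _ => A.integrable_step ν w a hτ v' s, Finset.mul_sum]
  exact Finset.sum_congr rfl fun s _ => A.integral_step ν w a hτ v' s

/-- Change of measure at time `min τ t` if only the mean of arm `a` changes. -/
lemma measure_update_eq_setLIntegral (A : BanditAlgorithm n U) (ν : Measure U)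
    [IsProbabilityMeasure ν] (w : Fin n → ℝ) (a : Fin n) {τ : Space n U → WithTop ℕ}
    (v' : ℝ) (t : ℕ) {B : Set (Space n U)}
    (hB : ∀ s : ℕ, MeasurableSet[A.filtration s] (B ∩ {ω | min (τ ω) t = s})) :
    banditLaw ν (gaussianInstance (Function.update w a v')) B
      = ∫⁻ ω in B, ENNReal.ofReal (Real.exp (A.stoppedLogLikelihood a τ (w a) v' t ω))
          ∂(banditLaw ν (gaussianInstance w)) := by
  -- The default `0` is never used, since the minimum with `t` is finite.
  let σ : Space n U → ℕ := fun ω => (min (τ ω) t).untopD 0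
  have hσ : ∀ ω, (σ ω : WithTop ℕ) = min (τ ω) t := by
    intro ω
    have : min (τ ω) (t : WithTop ℕ) ≠ ⊤ := ne_top_of_le_ne_top (WithTop.coe_ne_top) (min_le_right _ _)
    obtain ⟨s, hs⟩ := WithTop.ne_top_iff_exists.1 this
    simp only [σ, ← hs]
    rfl
  let r : Fin n → ℝ → ENNReal := fun b x =>
    ENNReal.ofReal (Real.exp (gaussianLogRatio (w b) (Function.update w a v' b) x))
  have hr : ∀ b, Measurable (r b) := fun b =>
    (Real.measurable_exp.comp (measurable_gaussianLogRatio _ _)).ennreal_ofReal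
  have hL : ∀ ω, A.likelihood r (σ ω) ω
      = ENNReal.ofReal (Real.exp (A.stoppedLogLikelihood a τ (w a) v' t ω)) := by
    intro ω
    have hle : σ ω ≤ t := by
      have := (hσ ω).trans_le (min_le_right _ _)
      exact_mod_cast this
    rw [likelihood, stoppedLogLikelihood, ← ENNReal.ofReal_prod_of_nonneg
      fun _ _ => (Real.exp_pos _).le, ← Real.exp_sum]
    congr 2
    -- Rounds from `σ ω` up to `t` contribute nothing to the stopped sum; before `σ ω`, arms other
    -- than `a` have log-ratio zero.
    rw [← Finset.sum_subset (Finset.range_subset_range.2 hle)]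
    · refine Finset.sum_congr rfl fun s hs => ?_
      have hs' : (s : WithTop ℕ) < τ ω := by
        have h1 : (s : WithTop ℕ) < σ ω := by exact_mod_cast Finset.mem_range.1 hs
        rw [hσ ω] at h1
        exact h1.trans_le (min_le_left _ _)
      by_cases harm : A.arm s ω = a
      · rw [Set.indicator_of_mem (show ω ∈ A.pulledAt a τ s from ⟨hs', harm⟩), reward, harm,
          Function.update_self]
      · rw [Set.indicator_of_notMem (fun h => harm h.2), Function.update_of_ne harm]
        simp [gaussianLogRatio]
    · intro s hs hs2
      refine Set.indicator_of_notMem (fun h => hs2 (Finset.mem_range.2 ?_)) _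
      have h1 : (s : WithTop ℕ) < σ ω := by
        rw [hσ ω]
        exact lt_min h.1 (by exact_mod_cast Finset.mem_range.1 hs)
      exact_mod_cast h1
  rw [A.measure_eq_setLIntegral_likelihood_stopped ν (gaussianInstance w)
    (gaussianInstance (Function.update w a v')) hr
    (fun b => gaussianReal_eq_withDensity (w b) (Function.update w a v' b)) σ]
  · simp only [hL]
  · intro s
    convert hB s using 5 with ω
    rw [← hσ ω]
    exact Nat.cast_inj.symm

/-- Comparison of the probabilities of an event that is decided by time `min τ t`. -/
lemma real_le_add_pulledAt (A : BanditAlgorithm n U) (ν : Measure U)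
    [IsProbabilityMeasure ν] (w : Fin n → ℝ) (a : Fin n) {τ : Space n U → WithTop ℕ}
    (hτ : IsStoppingTime A.filtration τ) (v' : ℝ) (t : ℕ) {B : Set (Space n U)}
    (hB : ∀ s : ℕ, MeasurableSet[A.filtration s] (B ∩ {ω | min (τ ω) t = s})) :
    (banditLaw ν (gaussianInstance w)).real B
        ≤ 2 * (banditLaw ν (gaussianInstance (Function.update w a v'))).real B
          + (v' - w a) ^ 2 * ∑ s ∈ Finset.range t,
            (banditLaw ν (gaussianInstance w)).real (A.pulledAt a τ s) ∧
      (banditLaw ν (gaussianInstance (Function.update w a v'))).real B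
        ≤ 2 * (banditLaw ν (gaussianInstance w)).real B
          + (v' - w a) ^ 2 * ∑ s ∈ Finset.range t,
            (banditLaw ν (gaussianInstance w)).real (A.pulledAt a τ s) := by
  set P := banditLaw ν (gaussianInstance w) with hP
  set P' := banditLaw ν (gaussianInstance (Function.update w a v')) with hP'
  set l := A.stoppedLogLikelihood a τ (w a) v' t with hl
  set N := ∑ s ∈ Finset.range t, P.real (A.pulledAt a τ s) with hN
  have hlm : Measurable l := A.measurable_stoppedLogLikelihood a hτ (w a) v' t
  have hexpm : Measurable (fun ω => Real.exp (l ω)) := Real.measurable_exp.comp hlm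
  have hli : Integrable l P := A.integrable_stoppedLogLikelihood ν w a hτ v' t
  have hlint : ∫ ω, l ω ∂P = -((v' - w a) ^ 2 / 2) * N :=
    A.integral_stoppedLogLikelihood ν w a hτ v' t
  -- Taking the whole space as the event shows that the stopped likelihood ratio has mean one.
  have hmass : ∫⁻ ω, ENNReal.ofReal (Real.exp (l ω)) ∂P = 1 := by
    have h := A.measure_update_eq_setLIntegral ν w a v' t (τ := τ) (B := Set.univ) fun s => by
      rw [Set.univ_inter]
      exact (hτ.min_const t).measurableSet_eq s
    rw [measure_univ, Measure.restrict_univ] at h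
    exact h.symm
  have hexpi : Integrable (fun ω => Real.exp (l ω)) P := by
    refine ⟨hexpm.aestronglyMeasurable, ?_⟩
    rw [hasFiniteIntegral_iff_ofReal (Filter.Eventually.of_forall fun ω => (Real.exp_pos _).le),
      hmass]
    exact ENNReal.one_lt_top
  have hexp1 : ∫ ω, Real.exp (l ω) ∂P = 1 := by
    rw [integral_eq_lintegral_of_nonneg_ae (Filter.Eventually.of_forall fun ω => (Real.exp_pos _).le)
      hexpm.aestronglyMeasurable, hmass, ENNReal.toReal_one]
  have hPB : P'.real B = ∫ ω in B, Real.exp (l ω) ∂P := by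
    rw [integral_eq_lintegral_of_nonneg_ae (Filter.Eventually.of_forall fun ω => (Real.exp_pos _).le)
      hexpm.aestronglyMeasurable, measureReal_def, A.measure_update_eq_setLIntegral ν w a v' t hB]
  have hφi : Integrable (fun ω => Real.exp (l ω) - 1 - l ω) P :=
    (hexpi.sub (integrable_const _)).sub hli
  -- The integrand is nonnegative, so restricting to `B` only decreases the integral; over the whole
  -- space it is the Kullback–Leibler divergence up to time `min τ t`.
  have hφ : ∫ ω in B, (Real.exp (l ω) - 1 - l ω) ∂P ≤ (v' - w a) ^ 2 / 2 * N := by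
    refine (setIntegral_le_integral hφi (Filter.Eventually.of_forall fun ω => ?_)).trans ?_
    · have := Real.add_one_le_exp (l ω)
      simp only [Pi.zero_apply]
      linarith
    · have h1 : ∫ ω, (Real.exp (l ω) - 1 - l ω) ∂P
          = ∫ ω, (Real.exp (l ω) - 1) ∂P - ∫ ω, l ω ∂P :=
        integral_sub (hexpi.sub (integrable_const _)) hli
      rw [h1, integral_sub hexpi (integrable_const _), hexp1, hlint]
      simp
  have hone : P.real B = ∫ ω in B, (1 : ℝ) ∂P := by simp
  -- With `y = exp (x / 2)` and `x ≤ 2 * y - 2`, the two inequalities reduce to `(2 * y - 1) ^ 2 ≥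
  -- 0` and `(y - 2) ^ 2 ≥ 0`.
  have hsq : ∀ x : ℝ, 1 ≤ 2 * Real.exp x + 2 * (Real.exp x - 1 - x) ∧
      Real.exp x ≤ 2 * 1 + 2 * (Real.exp x - 1 - x) := by
    intro x
    have h1 := Real.add_one_le_exp (x / 2)
    have h2 : Real.exp x = Real.exp (x / 2) ^ 2 := by
      rw [← Real.exp_nat_mul]
      congr 1
      push_cast
      ring
    constructor <;> nlinarith [sq_nonneg (2 * Real.exp (x / 2) - 1), sq_nonneg (Real.exp (x / 2) - 2)]
  constructor
  · have h : ∫ ω in B, (1 : ℝ) ∂P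
        ≤ ∫ ω in B, (2 * Real.exp (l ω) + 2 * (Real.exp (l ω) - 1 - l ω)) ∂P :=
      integral_mono (integrable_const _)
        ((hexpi.const_mul 2).add (hφi.const_mul 2)).integrableOn fun ω => (hsq (l ω)).1
    rw [integral_add (hexpi.const_mul 2).integrableOn (hφi.const_mul 2).integrableOn,
      integral_const_mul, integral_const_mul, ← hPB, ← hone] at h
    linarith
  · have h : ∫ ω in B, Real.exp (l ω) ∂P
        ≤ ∫ ω in B, (2 * 1 + 2 * (Real.exp (l ω) - 1 - l ω)) ∂P :=
      integral_mono hexpi.integrableOn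
        ((integrable_const _).add (hφi.const_mul 2)).integrableOn fun ω => (hsq (l ω)).2
    rw [integral_add (integrable_const _) (hφi.const_mul 2).integrableOn,
      integral_const_mul, integral_const_mul, ← hPB, ← hone] at h
    linarith

/-- Comparison of the probabilities of an event that is decided at time `τ < ⊤`, in terms of the
expected number of pulls of the only arm whose mean changes. -/
lemma real_le_add_pulls (A : BanditAlgorithm n U) (ν : Measure U)
    [IsProbabilityMeasure ν] (w : Fin n → ℝ) (a : Fin n) {τ : Space n U → WithTop ℕ}
    (hτ : IsStoppingTime A.filtration τ) (v' : ℝ) {G : Set (Space n U)}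
    (hG : ∀ s : ℕ, MeasurableSet[A.filtration s] (G ∩ {ω | τ ω = s}))
    (hfin : ∀ ω ∈ G, τ ω ≠ ⊤)
    (hpulls : ∫⁻ ω, A.pulls a τ ω ∂(banditLaw ν (gaussianInstance w)) ≠ ⊤) :
    (banditLaw ν (gaussianInstance w)).real G
        ≤ 2 * (banditLaw ν (gaussianInstance (Function.update w a v'))).real G
          + (v' - w a) ^ 2 *
            (∫⁻ ω, A.pulls a τ ω ∂(banditLaw ν (gaussianInstance w))).toReal ∧
      (banditLaw ν (gaussianInstance (Function.update w a v'))).real G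
        ≤ 2 * (banditLaw ν (gaussianInstance w)).real G
          + (v' - w a) ^ 2 *
            (∫⁻ ω, A.pulls a τ ω ∂(banditLaw ν (gaussianInstance w))).toReal := by
  set P := banditLaw ν (gaussianInstance w) with hP
  set P' := banditLaw ν (gaussianInstance (Function.update w a v')) with hP'
  set x := (∫⁻ ω, A.pulls a τ ω ∂P).toReal with hx
  let B : ℕ → Set (Space n U) := fun t => G ∩ {ω | τ ω ≤ t}
  have hBmono : Monotone B := fun s t hst =>
    Set.inter_subset_inter_right _ fun ω (h : τ ω ≤ s) =>
      le_trans h (Nat.cast_le.2 hst : (s : WithTop ℕ) ≤ t)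
  have hBU : ⋃ t, B t = G := by
    refine Set.Subset.antisymm (Set.iUnion_subset fun t => Set.inter_subset_left) fun ω hω => ?_
    obtain ⟨s, hs⟩ := WithTop.ne_top_iff_exists.1 (hfin ω hω)
    exact Set.mem_iUnion.2 ⟨s, hω, hs.symm.le⟩
  -- For `s ≤ t` this is the slice of `G` on `τ = s`, because `B t` excludes `τ > t`; for `s > t` it
  -- is empty.
  have hBs : ∀ t s : ℕ, MeasurableSet[A.filtration s] (B t ∩ {ω | min (τ ω) t = s}) := by
    intro t s
    by_cases hst : s ≤ t
    · convert hG s using 1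
      ext ω
      simp only [B, Set.mem_inter_iff, Set.mem_ofPred_eq, and_assoc]
      refine and_congr_right fun _ => ⟨fun h => ?_, fun h => ?_⟩
      · rw [← h.2, min_eq_left h.1]
      · have : τ ω ≤ t := by rw [h]; exact_mod_cast hst
        exact ⟨this, by rw [min_eq_left this, h]⟩
    · convert @MeasurableSet.empty _ (A.filtration s)
      refine Set.eq_empty_of_forall_notMem fun ω h => hst ?_
      have : (s : WithTop ℕ) ≤ t := by
        rw [← show min (τ ω) (t : WithTop ℕ) = s from h.2]
        exact min_le_right _ _
      exact_mod_cast this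
  have hN : ∀ t, ∑ s ∈ Finset.range t, P.real (A.pulledAt a τ s) ≤ x := by
    intro t
    rw [hx, A.lintegral_pulls a hτ]
    rw [A.lintegral_pulls a hτ] at hpulls
    simp only [measureReal_def]
    rw [← ENNReal.toReal_sum fun s _ => measure_ne_top _ _]
    exact ENNReal.toReal_mono hpulls (ENNReal.sum_le_tsum _)
  have hlim : ∀ Q : Measure (Space n U), IsProbabilityMeasure Q →
      Filter.Tendsto (fun t => Q.real (B t)) Filter.atTop (nhds (Q.real G)) := by
    intro Q _
    have h := tendsto_measure_iUnion_atTop (μ := Q) hBmono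
    rw [hBU] at h
    exact (ENNReal.tendsto_toReal (measure_ne_top _ _)).comp h
  have hstep := fun t => A.real_le_add_pulledAt ν w a hτ v' t (hBs t)
  have hl := hlim P inferInstance
  have hl' := hlim P' inferInstance
  constructor
  · exact le_of_tendsto_of_tendsto' hl ((hl'.const_mul 2).add_const _) fun t =>
      (hstep t).1.trans (by gcongr; exact hN t)
  · exact le_of_tendsto_of_tendsto' hl' ((hl.const_mul 2).add_const _) fun t =>
      (hstep t).2.trans (by gcongr; exact hN t)

end BanditAlgorithm

/-! ### Output events and the exchange of two arms. -/

lemma mem_topPositions {n : ℕ} (π : Equiv.Perm (Fin n)) (m : ℕ) (i : Fin n) :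
    π i ∈ topPositions π m ↔ (i : ℕ) < m := by
  simp [topPositions]

namespace BanditAlgorithm

variable {n : ℕ} {U : Type*} [MeasurableSpace U]

/-- The event that the algorithm stops and the recommended set satisfies `Q`. -/
def outputEvent (A : BanditAlgorithm n U) (τ : Space n U → WithTop ℕ)
    (Q : Finset (Fin n) → Prop) : Set (Space n U) :=
  {ω | ∃ t : ℕ, τ ω = (t : WithTop ℕ) ∧ Q (A.recommendation t ω)}

lemma measurableSet_outputEvent_inter (A : BanditAlgorithm n U) {τ : Space n U → WithTop ℕ}
    (hτ : IsStoppingTime A.filtration τ) (Q : Finset (Fin n) → Prop) (s : ℕ) :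
    MeasurableSet[A.filtration s] (A.outputEvent τ Q ∩ {ω | τ ω = s}) := by
  have h : A.outputEvent τ Q ∩ {ω | τ ω = s}
      = A.info s ⁻¹' (A.output s ⁻¹' {S | Q S}) ∩ {ω | τ ω = s} := by
    ext ω
    constructor
    · rintro ⟨⟨t, ht, hQ⟩, hs⟩
      have : t = s := by
        have h1 : (t : WithTop ℕ) = s := ht.symm.trans hs
        exact_mod_cast h1
      subst this
      exact ⟨hQ, hs⟩
    · rintro ⟨hQ, hs⟩
      exact ⟨⟨s, hs, hQ⟩, hs⟩
  rw [h]
  exact MeasurableSet.inter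
    ⟨_, A.measurable_output s (Set.toFinite {S | Q S}).measurableSet, rfl⟩
    (hτ.measurableSet_eq s)

lemma measurableSet_outputEvent (A : BanditAlgorithm n U) {τ : Space n U → WithTop ℕ}
    (hτ : IsStoppingTime A.filtration τ) (Q : Finset (Fin n) → Prop) :
    MeasurableSet (A.outputEvent τ Q) := by
  have h : A.outputEvent τ Q = ⋃ s : ℕ, A.outputEvent τ Q ∩ {ω | τ ω = s} := by
    ext ω
    simp only [Set.mem_iUnion, Set.mem_inter_iff, Set.mem_ofPred_eq, exists_and_left]
    exact ⟨fun h => ⟨h, h.imp fun _ => And.left⟩, And.left⟩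
  rw [h]
  exact MeasurableSet.iUnion fun s =>
    A.filtration.le s _ (A.measurableSet_outputEvent_inter hτ Q s)

lemma ne_top_of_mem_outputEvent (A : BanditAlgorithm n U) {τ : Space n U → WithTop ℕ}
    {Q : Finset (Fin n) → Prop} {ω : Space n U} (h : ω ∈ A.outputEvent τ Q) : τ ω ≠ ⊤ := by
  obtain ⟨t, ht, -⟩ := h
  rw [ht]
  exact WithTop.coe_ne_top

lemma outputEvent_disjoint (A : BanditAlgorithm n U) (τ : Space n U → WithTop ℕ)
    {Q Q' : Finset (Fin n) → Prop} (h : ∀ S, Q S → ¬ Q' S) :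
    Disjoint (A.outputEvent τ Q) (A.outputEvent τ Q') := by
  refine Set.disjoint_left.2 ?_
  rintro ω ⟨t, ht, hQ⟩ ⟨t', ht', hQ'⟩
  have : t = t' := by
    have h1 : (t : WithTop ℕ) = t' := ht.symm.trans ht'
    exact_mod_cast h1
  subst this
  exact h _ hQ hQ'

/-- Stopping with a set of positions of top arms that contains the position of arm `j`. -/
def hitEvent (A : BanditAlgorithm n U) (τ : Space n U → WithTop ℕ) (m : ℕ) (j : Fin n)
    (π : Equiv.Perm (Fin n)) : Set (Space n U) :=
  A.outputEvent τ fun S => π j ∈ S ∧ S ⊆ topPositions π m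

end BanditAlgorithm

/-- Giving arm `i` the mean of arm `j` makes the two arms exchangeable. -/
lemma update_comp_symm_mul_swap {n : ℕ} (μ : Fin n → ℝ) (π : Equiv.Perm (Fin n)) (i j : Fin n) :
    Function.update (μ ∘ (π * Equiv.swap i j).symm) ((π * Equiv.swap i j) i) (μ j)
      = Function.update (μ ∘ π.symm) (π i) (μ j) := by
  funext b
  obtain ⟨c, rfl⟩ := π.surjective b
  have h1 : (π * Equiv.swap i j) i = π j := by simp
  have h2 : (π * Equiv.swap i j).symm (π c) = Equiv.swap i j c := by
    rw [Equiv.symm_apply_eq]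
    simp
  rw [h1]
  simp only [Function.update_apply, Function.comp_apply, h2, EmbeddingLike.apply_eq_iff_eq,
    Equiv.symm_apply_apply]
  by_cases hcj : c = j
  · subst hcj
    simp
  · by_cases hci : c = i
    · subst hci
      simp
    · simp [hcj, hci, Equiv.swap_apply_of_ne_of_ne hci hcj]

namespace BanditAlgorithm

variable {n : ℕ} {U : Type*} [MeasurableSpace U]

/-- The modified law is invariant under `π ↦ π * Equiv.swap i j`, so reindexing the sum over
permutations turns the hit event into its swapped version. Both comparisons count pulls under the
original law. -/
lemma sum_real_hitEvent_le (A : BanditAlgorithm n U) (ν : Measure U) [IsProbabilityMeasure ν]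
    (μ : Fin n → ℝ) {τ : Space n U → WithTop ℕ} (hτ : IsStoppingTime A.filtration τ) (m : ℕ)
    (i j : Fin n)
    (hfin : ∀ π : Equiv.Perm (Fin n),
      ∫⁻ ω, A.pulls (π i) τ ω ∂(banditLaw ν (permuteInstance π (gaussianInstance μ))) ≠ ⊤) :
    ∑ π : Equiv.Perm (Fin n),
        (banditLaw ν (permuteInstance π (gaussianInstance μ))).real (A.hitEvent τ m j π)
      ≤ 4 * ∑ π : Equiv.Perm (Fin n), (banditLaw ν (permuteInstance π (gaussianInstance μ))).real
            (A.hitEvent τ m j (π * Equiv.swap i j))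
        + 3 * (μ j - μ i) ^ 2 * ∑ π : Equiv.Perm (Fin n), (∫⁻ ω, A.pulls (π i) τ ω
            ∂(banditLaw ν (permuteInstance π (gaussianInstance μ)))).toReal := by
  set P : Equiv.Perm (Fin n) → Measure (Space n U) := fun π =>
    banditLaw ν (permuteInstance π (gaussianInstance μ)) with hP
  set P' : Equiv.Perm (Fin n) → Measure (Space n U) := fun π =>
    banditLaw ν (gaussianInstance (Function.update (μ ∘ π.symm) (π i) (μ j))) with hP'
  have key : ∀ π π' : Equiv.Perm (Fin n),
      (P π).real (A.hitEvent τ m j π') ≤ 2 * (P' π).real (A.hitEvent τ m j π')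
          + (μ j - μ i) ^ 2 * (∫⁻ ω, A.pulls (π i) τ ω ∂(P π)).toReal ∧
      (P' π).real (A.hitEvent τ m j π') ≤ 2 * (P π).real (A.hitEvent τ m j π')
          + (μ j - μ i) ^ 2 * (∫⁻ ω, A.pulls (π i) τ ω ∂(P π)).toReal := by
    intro π π'
    have h := A.real_le_add_pulls ν (μ ∘ π.symm) (π i) hτ (μ j) (G := A.hitEvent τ m j π')
      (A.measurableSet_outputEvent_inter hτ _) (fun ω hω => A.ne_top_of_mem_outputEvent hω)
      (hfin π)
    rw [Function.comp_apply, Equiv.symm_apply_apply] at h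
    exact h
  have hswap : ∑ π, (P' π).real (A.hitEvent τ m j π)
      = ∑ π, (P' π).real (A.hitEvent τ m j (π * Equiv.swap i j)) := by
    rw [← Equiv.sum_comp (Equiv.mulRight (Equiv.swap i j))]
    refine Finset.sum_congr rfl fun π _ => ?_
    simp only [Equiv.coe_mulRight, hP', update_comp_symm_mul_swap]
  -- Chaining `p ≤ 2 * p' + c` with `p' ≤ 2 * q + c` gives `p ≤ 4 * q + 3 * c`, hence the constants
  -- 4 and 3.
  have h1 := Finset.sum_le_sum fun π (_ : π ∈ Finset.univ) => (key π π).1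
  have h2 := Finset.sum_le_sum fun π (_ : π ∈ Finset.univ) => (key π (π * Equiv.swap i j)).2
  rw [Finset.sum_add_distrib, ← Finset.mul_sum, ← Finset.mul_sum] at h1 h2
  rw [hswap] at h1
  linarith

/-- Double counting: on the correct event exactly `k` of the hit events occur, almost surely. -/
lemma card_mul_real_le_sum_real_hitEvent (A : BanditAlgorithm n U) {τ : Space n U → WithTop ℕ}
    (hτ : IsStoppingTime A.filtration τ) (m k : ℕ) (π : Equiv.Perm (Fin n))
    (P : Measure (Space n U)) [IsProbabilityMeasure P]
    (hcard : ∀ᵐ ω ∂P, ∀ t : ℕ, τ ω = (t : WithTop ℕ) → (A.recommendation t ω).card = k) :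
    k * P.real (A.outputEvent τ fun S => S ⊆ topPositions π m)
      ≤ ∑ j ∈ Finset.univ.filter (fun j : Fin n => (j : ℕ) < m),
          P.real (A.hitEvent τ m j π) := by
  have hm : ∀ j, MeasurableSet (A.hitEvent τ m j π) := fun j => A.measurableSet_outputEvent hτ _
  have hC := A.measurableSet_outputEvent hτ fun S => S ⊆ topPositions π m
  have hint : ∀ {B : Set (Space n U)}, MeasurableSet B →
      Integrable (B.indicator (1 : Space n U → ℝ)) P := fun hB =>
    (integrable_const (1 : ℝ)).indicator hB
  rw [← integral_indicator_one hC, ← integral_const_mul]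
  simp only [← integral_indicator_one (hm _)]
  rw [← integral_finsetSum _ fun j _ => hint (hm j)]
  refine integral_mono_ae ((hint hC).const_mul _) (integrable_finsetSum _ fun j _ => hint (hm j)) ?_
  filter_upwards [hcard] with ω hω
  by_cases h : ω ∈ A.outputEvent τ fun S => S ⊆ topPositions π m
  · rw [Set.indicator_of_mem h]
    obtain ⟨t, ht, hS⟩ := h
    set S := A.recommendation t ω with hSdef
    have hj : ∀ j : Fin n, (if π j ∈ S then (1 : ℝ) else 0)
        ≤ (A.hitEvent τ m j π).indicator 1 ω := by
      intro j
      split_ifs with hjS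
      · rw [Set.indicator_of_mem (show ω ∈ A.hitEvent τ m j π from ⟨t, ht, hjS, hS⟩)]
        simp
      · exact Set.indicator_nonneg (fun _ _ => zero_le_one) _
    refine le_trans (le_of_eq ?_) (Finset.sum_le_sum fun j _ => hj j)
    have hsum : ∑ b ∈ topPositions π m, (if b ∈ S then (1 : ℝ) else 0) = k := by
      rw [Finset.sum_boole, Finset.filter_mem_eq_inter, Finset.inter_eq_right.2 hS, hω t ht]
    rw [topPositions, Finset.sum_map] at hsum
    simpa using hsum.symm
  · rw [Set.indicator_of_notMem h, mul_zero]
    exact Finset.sum_nonneg fun j _ => Set.indicator_nonneg (fun _ _ => zero_le_one) _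

/-- The swapped event for `i` forces `π i` into the output, which is an error for `π`. It also
confines the output to the top positions with `π j` replaced by `π i`, so no other bad arm's
position can occur in it. -/
lemma sum_real_hitEvent_swap_le (A : BanditAlgorithm n U) {τ : Space n U → WithTop ℕ}
    (hτ : IsStoppingTime A.filtration τ) (m : ℕ) (π : Equiv.Perm (Fin n)) (j : Fin n)
    (hj : (j : ℕ) < m) (P : Measure (Space n U)) [IsProbabilityMeasure P] :
    ∑ i ∈ Finset.univ.filter (fun i : Fin n => m ≤ (i : ℕ)),
        P.real (A.hitEvent τ m j (π * Equiv.swap i j))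
      ≤ 1 - P.real (A.outputEvent τ fun S => S ⊆ topPositions π m) := by
  have hC := A.measurableSet_outputEvent hτ fun S => S ⊆ topPositions π m
  have hmem : ∀ i : Fin n, (π * Equiv.swap i j) j = π i := fun i => by simp
  rw [← probReal_compl_eq_one_sub hC, ← measureReal_biUnion_finset]
  · refine measureReal_mono (Set.iUnion₂_subset fun i hi => ?_) (measure_ne_top _ _)
    refine Disjoint.subset_compl_right (A.outputEvent_disjoint τ ?_)
    rintro S ⟨h1, -⟩ h2
    rw [hmem] at h1
    exact absurd ((mem_topPositions π m i).1 (h2 h1)) (not_lt.2 (Finset.mem_filter.1 hi).2)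
  · intro i hi i' hi' hii'
    refine A.outputEvent_disjoint τ ?_
    rintro S ⟨h1, -⟩ ⟨-, h2⟩
    have hi := (Finset.mem_filter.1 hi).2
    have hij : i ≠ j := fun h => by
      rw [h] at hi
      omega
    rw [hmem] at h1
    have h3 : π i = (π * Equiv.swap i' j) i := by
      rw [Equiv.Perm.mul_apply, Equiv.swap_apply_of_ne_of_ne hii' hij]
    have h4 := h2 h1
    rw [h3, mem_topPositions] at h4
    omega
  · exact fun i _ => A.measurableSet_outputEvent hτ _

end BanditAlgorithm

/-! ### Summation over the bad arms and conclusion. -/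

/-- The arithmetic that turns the bounds for the single arms into a bound for their sum. -/
lemma sum_ge_of_le_add {ι : Type*} (s : Finset ι) (X q d : ι → ℝ) {p F κ δ M : ℝ} (hF : 0 ≤ F)
    (hX : ∀ i ∈ s, 0 ≤ X i) (hq : ∀ i ∈ s, 0 ≤ q i) (hd : ∀ i ∈ s, 0 < d i)
    (hM : ∀ i ∈ s, (d i)⁻¹ ≤ M) (hM0 : 0 ≤ M) (hκ : 0 ≤ κ)
    (hδ : δ ≤ 1 / 16) (hp : F * (κ * (1 - δ)) ≤ p) (hqs : ∑ i ∈ s, q i ≤ F * δ)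
    (h : ∀ i ∈ s, p ≤ 4 * q i + 3 * d i * X i) :
    F * (1 / 64 * (-M + κ * ∑ i ∈ s, (d i)⁻¹)) ≤ ∑ i ∈ s, X i := by
  set S := ∑ i ∈ s, (d i)⁻¹ with hS
  have hS0 : 0 ≤ S := Finset.sum_nonneg fun i hi => (inv_pos.2 (hd i hi)).le
  have hX0 : 0 ≤ ∑ i ∈ s, X i := Finset.sum_nonneg hX
  have hi : ∀ i ∈ s, p * (d i)⁻¹ ≤ 4 * M * q i + 3 * X i := by
    intro i hi
    have h1 := mul_le_mul_of_nonneg_right (h i hi) (inv_pos.2 (hd i hi)).le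
    have h2 : (4 * q i + 3 * d i * X i) * (d i)⁻¹ = 4 * (q i * (d i)⁻¹) + 3 * X i := by
      have := (hd i hi).ne'
      field_simp
    have h3 := mul_le_mul_of_nonneg_left (hM i hi) (hq i hi)
    linarith
  have hsum := Finset.sum_le_sum hi
  rw [← Finset.mul_sum, Finset.sum_add_distrib, ← Finset.mul_sum, ← Finset.mul_sum, ← hS] at hsum
  have h1 : F * (κ * (15 / 16)) * S ≤ p * S := by
    refine mul_le_mul_of_nonneg_right (le_trans ?_ hp) hS0
    gcongr
    linarith
  have h2 : 4 * M * ∑ i ∈ s, q i ≤ 4 * M * (F * (1 / 16)) := by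
    gcongr
    exact hqs.trans (by gcongr)
  -- If `κ * S ≤ M` the claimed bound is nonpositive. Otherwise the estimate `3 * ∑ X ≥ F * (15 / 16
  -- * κ * S - M / 4)` leaves room for the constant `1 / 64`.
  by_cases hc : κ * S ≤ M
  · refine le_trans ?_ hX0
    exact mul_nonpos_of_nonneg_of_nonpos hF (by linarith)
  · have h3 := mul_le_mul_of_nonneg_left (not_le.1 hc).le hF
    have h4 : 0 ≤ F * M := mul_nonneg hF hM0
    nlinarith

theorem theorem1
    {n : ℕ} (hn : 0 < n)
    (μ : Fin n → ℝ) (hμ : Antitone μ)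
    (ε δ : ℝ) (hε : 0 < ε) (hδ : δ ∈ Set.Ioo (0 : ℝ) (1 / 16))
    (m k : ℕ)
    (hm : m = (Finset.univ.filter fun i : Fin n => μ i > μ ⟨0, hn⟩ - ε).card)
    (hmn : m < n)
    {U : Type*} [MeasurableSpace U] (ν : Measure U) [IsProbabilityMeasure ν]
    (A : BanditAlgorithm n U)
    (τ : BanditAlgorithm.Space n U → WithTop ℕ)
    (hτ : IsStoppingTime A.filtration τ)
    (hcard : ∀ π : Equiv.Perm (Fin n),
      ∀ᵐ ω ∂(banditLaw ν (permuteInstance π (gaussianInstance μ))),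
        ∀ t : ℕ, τ ω = (t : WithTop ℕ) → (A.recommendation t ω).card = k)
    (hcorrect : ∀ π : Equiv.Perm (Fin n),
      (banditLaw ν (permuteInstance π (gaussianInstance μ))).real
        {ω | ∃ t : ℕ, τ ω = (t : WithTop ℕ) ∧
          A.recommendation t ω ⊆ topPositions π m} ≥ 1 - δ) :
    (∑ π : Equiv.Perm (Fin n),
        ∫⁻ ω, ∑ i : Fin n, A.pulls (π i) τ ω
          ∂(banditLaw ν (permuteInstance π (gaussianInstance μ)))) / (n.factorial : ENNReal)
      ≥ ENNReal.ofReal ((1 / 64 : ℝ) *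
          (-((μ ⟨0, hn⟩ - μ ⟨m, hmn⟩) ^ 2)⁻¹
            + (k : ℝ) / (m : ℝ) *
              ∑ i ∈ Finset.univ.filter (fun i : Fin n => m ≤ (i : ℕ)),
                ((μ ⟨0, hn⟩ - μ i) ^ 2)⁻¹)) := by

  set P : Equiv.Perm (Fin n) → Measure (BanditAlgorithm.Space n U) := fun π =>
    banditLaw ν (permuteInstance π (gaussianInstance μ)) with hP
  have hPprob : ∀ π, IsProbabilityMeasure (P π) := fun π =>
    inferInstanceAs (IsProbabilityMeasure (banditLaw ν (gaussianInstance (μ ∘ π.symm))))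
  let x : Fin n → ENNReal := fun i => ∑ π, ∫⁻ ω, A.pulls (π i) τ ω ∂(P π)
  have hpm : ∀ i, Measurable (A.pulls i τ) := fun i =>
    Measurable.tsum fun s => measurable_one.indicator
      (A.filtration.le s _ (A.measurableSet_pulledAt i hτ s))
  have htotal : ∑ π, ∫⁻ ω, ∑ i, A.pulls (π i) τ ω ∂(P π) = ∑ i, x i := by
    simp only [x]
    rw [Finset.sum_comm]
    exact Finset.sum_congr rfl fun π _ => lintegral_finsetSum _ fun i _ => hpm _
  have hfact : (n.factorial : ENNReal) ≠ 0 := by exact_mod_cast n.factorial_ne_zero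
  have hfact' : (0 : ℝ) < n.factorial := by exact_mod_cast n.factorial_pos
  rw [htotal, ge_iff_le, ENNReal.le_div_iff_mul_le (Or.inl hfact) (Or.inl (ENNReal.natCast_ne_top _))]
  by_cases htop : ∃ i, x i = ⊤
  · obtain ⟨i, hi⟩ := htop
    rw [ENNReal.sum_eq_top.2 ⟨i, Finset.mem_univ i, hi⟩]
    exact le_top
  push Not at htop
  have hfin : ∀ i π, ∫⁻ ω, A.pulls (π i) τ ω ∂(P π) ≠ ⊤ := fun i π =>
    (ENNReal.sum_ne_top.1 (htop i)) π (Finset.mem_univ π)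
  have hxreal : ∀ i, (x i).toReal = ∑ π, (∫⁻ ω, A.pulls (π i) τ ω ∂(P π)).toReal := fun i =>
    ENNReal.toReal_sum fun π _ => hfin i π
  -- the `m` best arms are separated from the others
  have hm0 : 0 < m := by
    rw [hm]
    exact Finset.card_pos.2 ⟨⟨0, hn⟩, by simp [hε]⟩
  have hgap : 0 < μ ⟨0, hn⟩ - μ ⟨m, hmn⟩ := by
    by_contra hle
    -- Without a gap, the arms `0, …, m` would be `m + 1` members of a set of size `m`.
    have hsub : Finset.Iic (⟨m, hmn⟩ : Fin n)
        ⊆ Finset.univ.filter fun i : Fin n => μ i > μ ⟨0, hn⟩ - ε := by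
      intro i hi
      have := hμ (Finset.mem_Iic.1 hi)
      exact Finset.mem_filter.2 ⟨Finset.mem_univ _, by linarith⟩
    have := Finset.card_le_card hsub
    rw [← hm, Fin.card_Iic] at this
    simp at this
  let top := Finset.univ.filter fun j : Fin n => (j : ℕ) < m
  let bad := Finset.univ.filter fun i : Fin n => m ≤ (i : ℕ)
  have htopcard : top.card = m := by
    have : top = Finset.Iio (⟨m, hmn⟩ : Fin n) := by
      ext j
      simp [top, Fin.lt_def]
    rw [this, Fin.card_Iio]
  -- some top arm is output often
  obtain ⟨j, hjtop, hj⟩ : ∃ j ∈ top,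
      n.factorial * ((k : ℝ) / m * (1 - δ)) ≤ ∑ π, (P π).real (A.hitEvent τ m j π) := by
    -- Averaging over the `m` top arms after summing over `π` gives a single `j` that serves all
    -- permutations and all bad arms at once.
    refine Finset.exists_le_of_sum_le (Finset.card_pos.1 (htopcard ▸ hm0)) ?_
    rw [Finset.sum_const, htopcard, nsmul_eq_mul, Finset.sum_comm]
    have h1 : ∀ π, (k : ℝ) * (1 - δ) ≤ ∑ j ∈ top, (P π).real (A.hitEvent τ m j π) := fun π =>
      (mul_le_mul_of_nonneg_left (hcorrect π) (Nat.cast_nonneg k)).trans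
        (A.card_mul_real_le_sum_real_hitEvent hτ m k π (P π) (hcard π))
    refine le_trans (le_of_eq ?_) (Finset.sum_le_sum fun π _ => h1 π)
    rw [Finset.sum_const, Finset.card_univ, Fintype.card_perm, Fintype.card_fin, nsmul_eq_mul]
    have : (m : ℝ) ≠ 0 := by exact_mod_cast hm0.ne'
    field_simp
  have hjm : (j : ℕ) < m := (Finset.mem_filter.1 hjtop).2
  let q : Fin n → ℝ := fun i => ∑ π, (P π).real (A.hitEvent τ m j (π * Equiv.swap i j))
  have hq : ∑ i ∈ bad, q i ≤ n.factorial * δ := by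
    simp only [q]
    rw [Finset.sum_comm]
    have h1 : ∀ π, ∑ i ∈ bad, (P π).real (A.hitEvent τ m j (π * Equiv.swap i j)) ≤ δ := fun π =>
      (A.sum_real_hitEvent_swap_le hτ m π j hjm (P π)).trans (sub_le_comm.1 (hcorrect π))
    refine (Finset.sum_le_sum fun π _ => h1 π).trans (le_of_eq ?_)
    rw [Finset.sum_const, Finset.card_univ, Fintype.card_perm, Fintype.card_fin, nsmul_eq_mul]
  have hgapi : ∀ i ∈ bad, μ ⟨0, hn⟩ - μ ⟨m, hmn⟩ ≤ μ ⟨0, hn⟩ - μ i := fun i hi =>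
    sub_le_sub_left (hμ (Fin.le_def.2 (Finset.mem_filter.1 hi).2)) _
  have hmain := sum_ge_of_le_add bad (fun i => (x i).toReal) q
    (fun i => (μ ⟨0, hn⟩ - μ i) ^ 2) (M := ((μ ⟨0, hn⟩ - μ ⟨m, hmn⟩) ^ 2)⁻¹) hfact'.le
    (fun _ _ => ENNReal.toReal_nonneg)
    (fun _ _ => Finset.sum_nonneg fun _ _ => measureReal_nonneg)
    (fun i hi => pow_pos (hgap.trans_le (hgapi i hi)) 2)
    (fun i hi => inv_anti₀ (pow_pos hgap 2) (pow_le_pow_left₀ hgap.le (hgapi i hi) 2))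
    (inv_nonneg.2 (sq_nonneg _)) (by positivity) hδ.2.le hj hq fun i hi => by
      refine (A.sum_real_hitEvent_le ν μ hτ m i j (hfin i)).trans ?_
      rw [← hxreal i]
      have h0 : 0 ≤ μ j - μ i :=
        sub_nonneg.2 (hμ (Fin.le_def.2 (hjm.le.trans (Finset.mem_filter.1 hi).2)))
      have h1 : μ j ≤ μ ⟨0, hn⟩ := hμ (Fin.le_def.2 (Nat.zero_le _))
      -- Nothing is known about which top arm `j` is, so its gap to `i` is bounded by that of the
      -- best arm.
      have h2 : (μ j - μ i) ^ 2 ≤ (μ ⟨0, hn⟩ - μ i) ^ 2 := pow_le_pow_left₀ h0 (by linarith) 2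
      gcongr
  have hall : ∑ i ∈ bad, (x i).toReal ≤ (∑ i, x i).toReal := by
    rw [ENNReal.toReal_sum fun i _ => htop i]
    exact Finset.sum_le_univ_sum_of_nonneg fun i => ENNReal.toReal_nonneg
  rw [← ENNReal.ofReal_natCast, mul_comm, ← ENNReal.ofReal_mul hfact'.le]
  exact ENNReal.ofReal_le_of_le_toReal (hmain.trans hall)
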